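/- A \emph{machine} is a partial computable function $U$ from binary strings to binary strings; its complexity function is $C_U(x)=\min\{|p| : U(p)=x\}$ (with $C_U(x)=\infty$ if $x$ is not a value of $U$). The machine $U$ is \emph{optimal} if for every machine $V$ there is a constant $c$ such that $C_U(x)\le C_V(x)+c$ for all binary strings $x$. A \emph{probabilistic algorithm} $A$ takes a binary string as input, may toss a fair coin during its computation, and may fail to halt. For such an algorithm and a machine $U$, let $\varepsilon_n(A)$ be the probability that $A$ errs in deciding $\mathrm{dom}(U)$ on an input $x$ distributed uniformly among all binary strings of length at most $n$, the coin tosses being independent of $x$; here $A$ errs on $x$ if $x\in\mathrm{dom}(U)$ and $A$ does not output $1$, or $x\notin\mathrm{dom}(U)$ and $A$ does not output $0$ (not halting is an error in both cases). Let $\overline{E}(A)=\limsup_{n\to\infty}\varepsilon_n(A)$ and $\underline{E}(A)=\liminf_{n\to\infty}\varepsilon_n(A)$. \textbf{Theorem.} Let $U$ be an optimal machine. Then: (a) $\underline{E}(A)>0$ for every probabilistic algorithm $A$; (b) there exists $\varepsilon>0$ (depending only on $U$) such that $\overline{E}(A)\ge\varepsilon$ for every probabilistic algorithm $A$. -/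

import Mathlib

open Filter MeasureTheory ProbabilityTheory
open scoped ENNReal

noncomputable section

/-- A machine: a partial computable function whose arguments and values are binary strings. -/
def IsMachine (U : List Bool →. List Bool) : Prop :=
  Partrec U

/-- The complexity function of a machine, `min {|p| : U(p) = x}`, equal to `⊤` if `x` is not a
value of the machine. -/
def complexity (U : List Bool →. List Bool) (x : List Bool) : ℕ∞ :=
  ⨅ p ∈ {p : List Bool | x ∈ U p}, (p.length : ℕ∞)

/-- A machine is optimal if its complexity function is minimal up to an additive constant. -/
def IsOptimal (U : List Bool →. List Bool) : Prop :=
  IsMachine U ∧ ∀ V : List Bool →. List Bool, IsMachine V →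
    ∃ c : ℕ, ∀ x : List Bool, complexity U x ≤ complexity V x + c

/-- A coin-tossing algorithm: an ordinary computation that may, at any moment, ask for the next
outcome of a coin. On input `x`, after the outcomes `r` (in the order of tossing) have been
received and before any other one is received, there are three possibilities for the computation:
it asks for the next toss (`act x r` is defined and equal to `none`), it halts with an output `v`
(`act x r` is defined and equal to `some v`), or it runs forever (`act x r` is undefined). This is
determined by a partial computable function of `x` and `r`, and every such function is the
behaviour of a coin-tossing computation. -/
structure ProbAlgorithm where
  act : List Bool → List Bool →. Option ℕ
  partrec_act : Partrec₂ act

/-- The outcomes of the first `k` tosses in an infinite sequence of tosses. -/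
def firstTosses (ω : ℕ → Bool) (k : ℕ) : List Bool :=
  (List.range k).map ω

/-- The algorithm `A`, run on the input `x` with `ω` as the sequence of tosses, halts with the
output `v`. The witness `k` is the number of tosses that the run uses. -/
def ProbAlgorithm.Outputs (A : ProbAlgorithm) (x : List Bool) (ω : ℕ → Bool) (v : ℕ) : Prop :=
  ∃ k : ℕ, (∀ j < k, none ∈ A.act x (firstTosses ω j)) ∧ some v ∈ A.act x (firstTosses ω k)

/-- Every set of binary strings is measurable. -/
instance binaryStringsMeasurableSpace : MeasurableSpace (List Bool) := ⊤

/-- The law of an infinite sequence of independent tosses of a fair coin. -/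
def coinMeasure : Measure (ℕ → Bool) :=
  Measure.infinitePi fun _ : ℕ => uniformOn (Set.univ : Set Bool)

/-- The uniform distribution on the set of binary strings of length at most `n`. -/
def uniformInput (n : ℕ) : Measure (List Bool) :=
  uniformOn {x : List Bool | x.length ≤ n}

/-- The event that `A` errs as a decision algorithm for the set `S`: the input is in `S` and `A`
does not output `1`, or the input is not in `S` and `A` does not output `0`. -/
def errorEvent (S : Set (List Bool)) (A : ProbAlgorithm) : Set (List Bool × (ℕ → Bool)) :=
  {z | (z.1 ∈ S ∧ ¬ A.Outputs z.1 z.2 1) ∨ (z.1 ∉ S ∧ ¬ A.Outputs z.1 z.2 0)}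

/-- The probability that `A` errs on an input distributed uniformly among the strings of length
at most `n`, the coin tosses being independent of the choice of the input. -/
def errorRate (S : Set (List Bool)) (A : ProbAlgorithm) (n : ℕ) : ℝ≥0∞ :=
  ((uniformInput n).prod coinMeasure) (errorEvent S A)

/-- The upper error rate. -/
def upperErrorRate (S : Set (List Bool)) (A : ProbAlgorithm) : ℝ≥0∞ :=
  limsup (errorRate S A) atTop

/-- The lower error rate. -/
def lowerErrorRate (S : Set (List Bool)) (A : ProbAlgorithm) : ℝ≥0∞ :=
  liminf (errorRate S A) atTop

end

/-! An algorithm that rarely errs at length `n` makes it possible to find, by search, almost all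
programs of length at most `n` on which `U` halts. Let `N` be the number of strings of length at
most `n`. If the error is below `2⁻ᵉ`, then halting programs found so far plus the average number of
inputs answered `0` eventually reach `N - N/2ᵉ`. This event is `Σ₁`, so it can be awaited: this is
`IsCertificate`. Conversely, wrong answers `0` have total weight at most `N/2ᵉ`, so any such
certificate misses fewer than `2^(n+2-e)` halting programs (`IsCertificate.card_le`).

A machine `V` reads `0ᵈ1q`, recovers `e` and `n`, finds a certificate and prints `1ᴹq`, longer than
every output of the listed programs. By optimality each such string has a `U`-program of length at
most `n` when `d` is the optimality constant for `V`. These programs are distinct, halt and are not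
listed; the parameters make their number `2^|q|` equal to the bound `2^(n+2-e)`, a contradiction.

The argument uses the algorithm only at length `n`, so it applies to a computable family indexed by
`n` (`exists_forall_le_errorRate`). A constant family gives (a). A family listing every algorithm
infinitely often gives (b), with `ε` independent of the algorithm. -/

/-! ### Closure properties of `Σ₁` predicates. -/

/-- A predicate is `Σ₁` if it is the projection of a primitive recursive relation. -/
def IsSigmaOne {α : Type*} [Primcodable α] (p : α → Prop) : Prop :=
  ∃ q : α → ℕ → Prop, PrimrecRel q ∧ ∀ a, p a ↔ ∃ t, q a t

namespace IsSigmaOne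

variable {α β : Type*} [Primcodable α] [Primcodable β]

theorem of_primrecPred {p : α → Prop} (hp : PrimrecPred p) : IsSigmaOne p :=
  ⟨fun a _ => p a, hp.comp Primrec.fst, fun _ => by simp⟩

theorem comp {p : β → Prop} (hp : IsSigmaOne p) {f : α → β} (hf : Primrec f) :
    IsSigmaOne fun a => p (f a) := by
  obtain ⟨q, hq, h⟩ := hp
  exact ⟨fun a t => q (f a) t, hq.comp (hf.comp Primrec.fst) Primrec.snd, fun a => h _⟩

theorem and {p p' : α → Prop} (hp : IsSigmaOne p) (hp' : IsSigmaOne p') :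
    IsSigmaOne fun a => p a ∧ p' a := by
  obtain ⟨q, hq, h⟩ := hp
  obtain ⟨q', hq', h'⟩ := hp'
  refine ⟨fun a t => q a t.unpair.1 ∧ q' a t.unpair.2, ?_, fun a => ?_⟩
  · exact (hq.comp Primrec.fst (Primrec.fst.comp (Primrec.unpair.comp Primrec.snd))).and
      (hq'.comp Primrec.fst (Primrec.snd.comp (Primrec.unpair.comp Primrec.snd)))
  · simp only [h, h']
    constructor
    · rintro ⟨⟨s, hs⟩, t, ht⟩
      exact ⟨Nat.pair s t, by simpa using ⟨hs, ht⟩⟩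
    · rintro ⟨t, h₁, h₂⟩
      exact ⟨⟨_, h₁⟩, _, h₂⟩

theorem exists_snd {p : α × β → Prop} (hp : IsSigmaOne p) : IsSigmaOne fun a => ∃ b, p (a, b) := by
  obtain ⟨q, hq, h⟩ := hp
  refine ⟨fun a t => ∃ b ∈ (Encodable.decode (α := β) t.unpair.1).toList, q (a, b) t.unpair.2,
    ?_, fun a => ?_⟩
  · have hR : PrimrecRel fun (b : β) (z : α × ℕ) => q (z.1, b) z.2.unpair.2 :=
      hq.comp (Primrec.pair (Primrec.fst.comp Primrec.snd) Primrec.fst)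
        (Primrec.snd.comp (Primrec.unpair.comp (Primrec.snd.comp Primrec.snd)))
    exact hR.exists_mem_list.comp (Primrec.optionToList.comp (Primrec.decode.comp
      (Primrec.fst.comp (Primrec.unpair.comp Primrec.snd)))) Primrec.id
  · constructor
    · rintro ⟨b, hb⟩
      obtain ⟨t, ht⟩ := (h _).1 hb
      exact ⟨Nat.pair (Encodable.encode b) t, b, by simp, by simpa using ht⟩
    · rintro ⟨t, b, -, hb⟩
      exact ⟨b, (h _).2 ⟨_, hb⟩⟩

/-- Finitely many witnesses have a common bound, so the bounded quantifier moves inside the search.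
-/
theorem forall_mem_list {p : β × α → Prop} (hp : IsSigmaOne p) :
    IsSigmaOne fun z : List β × α => ∀ b ∈ z.1, p (b, z.2) := by
  obtain ⟨q, hq, h⟩ := hp
  refine ⟨fun z t => ∀ b ∈ z.1, ∃ s ∈ List.range t, q (b, z.2) s, ?_, fun z => ?_⟩
  · have h₁ : PrimrecRel fun (s : ℕ) (w : β × α) => q w s :=
      hq.comp Primrec.snd Primrec.fst
    have h₂ : PrimrecRel fun (t : ℕ) (w : β × α) => ∃ s ∈ List.range t, q w s :=
      h₁.exists_mem_list.comp (Primrec.list_range.comp Primrec.fst) Primrec.snd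
    have h₃ : PrimrecRel fun (b : β) (w : α × ℕ) => ∃ s ∈ List.range w.2, q (b, w.1) s :=
      h₂.comp (Primrec.snd.comp Primrec.snd)
        (Primrec.pair Primrec.fst (Primrec.fst.comp Primrec.snd))
    exact h₃.forall_mem_list.comp (Primrec.fst.comp Primrec.fst)
      (Primrec.pair (Primrec.snd.comp Primrec.fst) Primrec.snd)
  · constructor
    · intro H
      choose! f hf using fun b hb => (h _).1 (H b hb)
      refine ⟨(z.1.map f).sum + 1, fun b hb => ⟨f b, List.mem_range.2 ?_, hf b hb⟩⟩
      exact Nat.lt_succ_of_le (List.single_le_sum (by simp) _ (List.mem_map_of_mem hb))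
    · rintro ⟨t, H⟩ b hb
      obtain ⟨s, -, hs⟩ := H b hb
      exact (h _).2 ⟨s, hs⟩

theorem mem_of_partrec {f : α →. β} (hf : Partrec f) :
    IsSigmaOne fun z : α × β => z.2 ∈ f z.1 := by
  obtain ⟨c, hc⟩ := Nat.Partrec.Code.exists_code.1 hf
  refine ⟨fun z t => Nat.Partrec.Code.evaln t c (Encodable.encode z.1) =
    some (Encodable.encode z.2), ?_, fun z => ?_⟩
  · exact Primrec.eq.comp (Nat.Partrec.Code.primrec_evaln.comp
      (Primrec.pair (Primrec.pair Primrec.snd (Primrec.const c))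
        (Primrec.encode.comp (Primrec.fst.comp Primrec.fst))))
      (Primrec.option_some.comp (Primrec.encode.comp (Primrec.snd.comp Primrec.fst)))
  · have := @Nat.Partrec.Code.evaln_complete c (Encodable.encode z.1) (Encodable.encode z.2)
    rw [hc] at this
    simpa using this

/-- Uniformization: a `Σ₁` relation has a partial recursive selector. -/
theorem exists_selector {p : α × β → Prop} (hp : IsSigmaOne p) :
    ∃ g : α →. β, Partrec g ∧ (∀ a, ∀ b ∈ g a, p (a, b)) ∧ ∀ a b, p (a, b) → (g a).Dom := by
  classical
  obtain ⟨q, hq, h⟩ := hp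
  -- Each `n` codes a candidate `b` with a witness for it; the selector returns the first candidate
  -- that checks.
  let F : α → ℕ → Option β := fun a n =>
    (Encodable.decode (α := β) n.unpair.1).bind fun b =>
      if q (a, b) n.unpair.2 then some b else none
  have hF : Primrec₂ F := by
    refine Primrec.option_bind (Primrec.decode.comp
      (Primrec.fst.comp (Primrec.unpair.comp Primrec.snd))) ?_
    refine Primrec.ite (hq.comp (Primrec.pair (Primrec.fst.comp Primrec.fst) Primrec.snd)
      (Primrec.snd.comp (Primrec.unpair.comp (Primrec.snd.comp Primrec.fst))))
      (Primrec.option_some.comp Primrec.snd) (Primrec.const none)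
  refine ⟨fun a => Nat.rfindOpt (F a), Partrec.rfindOpt hF.to_comp, fun a b hb => ?_,
    fun a b hb => ?_⟩
  · obtain ⟨n, hn⟩ := Nat.rfindOpt_spec hb
    simp only [F, Option.mem_def, Option.bind_eq_some_iff] at hn
    obtain ⟨b', -, hb'⟩ := hn
    split_ifs at hb' with hq'
    cases hb'
    exact (h _).2 ⟨_, hq'⟩
  · obtain ⟨t, ht⟩ := (h _).1 hb
    rw [Nat.rfindOpt_dom]
    exact ⟨Nat.pair (Encodable.encode b) t, b, by simp [F, ht]⟩

end IsSigmaOne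

/-! ### Counting strings and measuring cylinders. -/

/-- The binary strings of length exactly `k`. -/
noncomputable def stringsOfLength (k : ℕ) : Finset (List Bool) :=
  (List.finite_length_eq Bool k).toFinset

/-- The binary strings of length at most `n`. -/
noncomputable def shortStrings (n : ℕ) : Finset (List Bool) :=
  (List.finite_length_le Bool n).toFinset

@[simp]
theorem mem_stringsOfLength {k : ℕ} {x : List Bool} : x ∈ stringsOfLength k ↔ x.length = k := by
  simp [stringsOfLength]

@[simp]
theorem mem_shortStrings {n : ℕ} {x : List Bool} : x ∈ shortStrings n ↔ x.length ≤ n := by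
  simp [shortStrings]

theorem coe_shortStrings (n : ℕ) :
    (shortStrings n : Set (List Bool)) = {x : List Bool | x.length ≤ n} := by
  ext; simp

theorem card_stringsOfLength (k : ℕ) : (stringsOfLength k).card = 2 ^ k := by
  have h : Fintype.card (List.Vector Bool k) = 2 ^ k := by simp
  rw [← h, ← Fintype.card_coe]
  exact Fintype.card_congr (Equiv.subtypeEquivRight fun _ => mem_stringsOfLength)

theorem card_shortStrings (n : ℕ) : (shortStrings n).card + 1 = 2 ^ (n + 1) := by
  induction n with
  | zero =>
    have : shortStrings 0 = {[]} := by ext; simp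
    simp [this]
  | succ n ih =>
    have h : shortStrings (n + 1) = shortStrings n ∪ stringsOfLength (n + 1) := by
      ext; simp; omega
    rw [h, Finset.card_union_of_disjoint, card_stringsOfLength]
    · rw [pow_succ 2 (n + 1)]; omega
    · rw [Finset.disjoint_left]
      simp; omega

theorem card_shortStrings_pos (n : ℕ) : 0 < (shortStrings n).card :=
  Finset.card_pos.2 ⟨[], by simp⟩

instance isProbabilityMeasure_coinMeasure : IsProbabilityMeasure coinMeasure := by
  unfold coinMeasure; infer_instance

instance isProbabilityMeasure_uniformInput (n : ℕ) : IsProbabilityMeasure (uniformInput n) :=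
  isProbabilityMeasure_uniformOn (List.finite_length_le Bool n) ⟨[], by simp⟩

@[simp]
theorem length_firstTosses (ω : ℕ → Bool) (k : ℕ) : (firstTosses ω k).length = k := by
  simp [firstTosses]

theorem take_firstTosses (ω : ℕ → Bool) {j k : ℕ} (h : j ≤ k) :
    (firstTosses ω k).take j = firstTosses ω j := by
  simp [firstTosses, ← List.map_take, List.take_range, h]

/-- The sequences of tosses that start with `r`. -/
def tossesWithPrefix (r : List Bool) : Set (ℕ → Bool) :=
  {ω | firstTosses ω r.length = r}

/-- The product form is what `Measure.infinitePi_pi` evaluates; the default `false` is never read.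
-/
theorem tossesWithPrefix_eq_pi (r : List Bool) :
    tossesWithPrefix r = Set.pi (Finset.range r.length) fun i => {r.getD i false} := by
  ext ω
  simp only [tossesWithPrefix, firstTosses, Set.mem_ofPred_eq, Set.mem_pi, Finset.coe_range,
    Set.mem_Iio, Set.mem_singleton_iff]
  constructor
  · intro h i hi
    have := congrArg (fun l => l.getD i false) h
    simpa [hi] using this
  · intro h
    refine List.ext_getElem (by simp) fun i h₁ h₂ => ?_
    simpa [h₂] using h i h₂

theorem measurableSet_tossesWithPrefix (r : List Bool) : MeasurableSet (tossesWithPrefix r) := by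
  rw [tossesWithPrefix_eq_pi]
  exact MeasurableSet.pi (Finset.countable_toSet _) fun _ _ => MeasurableSet.singleton _

theorem coinMeasure_tossesWithPrefix (r : List Bool) :
    coinMeasure (tossesWithPrefix r) = (2 ^ r.length : ℝ≥0∞)⁻¹ := by
  rw [tossesWithPrefix_eq_pi, coinMeasure, Measure.infinitePi_pi]
  · have : ∀ b : Bool, uniformOn (Set.univ : Set Bool) {b} = (2 : ℝ≥0∞)⁻¹ := fun b => by
      rw [uniformOn_univ]; simp
    rw [Finset.prod_congr rfl fun i _ => this _]
    simp [ENNReal.inv_pow]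
  · exact fun _ _ => MeasurableSet.singleton _

theorem uniformInput_apply (n : ℕ) (s : Finset (List Bool)) (hs : s ⊆ shortStrings n) :
    uniformInput n s = s.card * ((shortStrings n).card : ℝ≥0∞)⁻¹ := by
  have : MeasurableSingletonClass (List Bool) := ⟨fun _ => trivial⟩
  rw [uniformInput, ← coe_shortStrings, uniformOn_apply_finset, Finset.inter_eq_right.2 hs,
    ENNReal.div_eq_inv_mul, mul_comm]

/-- The event that the input and the first tosses form a pair in `T`. -/
def prefixEvent (T : Finset (List Bool × List Bool)) : Set (List Bool × (ℕ → Bool)) :=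
  ⋃ z ∈ T, {z.1} ×ˢ tossesWithPrefix z.2

/-- Prefixes of one common length `K` give disjoint cylinders, so the measure is a count. -/
theorem prod_prefixEvent {n K : ℕ} {T : Finset (List Bool × List Bool)}
    (hT : ∀ z ∈ T, z.1.length ≤ n ∧ z.2.length = K) :
    ((uniformInput n).prod coinMeasure) (prefixEvent T) =
      T.card * (((shortStrings n).card : ℝ≥0∞)⁻¹ * (2 ^ K)⁻¹) := by
  rw [prefixEvent, measure_biUnion_finset]
  · rw [Finset.sum_congr rfl (g := fun _ => ((shortStrings n).card : ℝ≥0∞)⁻¹ * (2 ^ K)⁻¹),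
      Finset.sum_const, nsmul_eq_mul]
    intro z hz
    have := uniformInput_apply n {z.1} (by simpa using (hT z hz).1)
    rw [Finset.coe_singleton] at this
    rw [Measure.prod_prod, this, coinMeasure_tossesWithPrefix, (hT z hz).2]
    simp
  · intro z hz w hw hzw
    rw [Function.onFun, Set.disjoint_left]
    rintro ⟨x, ω⟩ ⟨h₁, h₂⟩ ⟨h₃, h₄⟩
    refine hzw (Prod.ext (h₁.symm.trans h₃) ?_)
    have h₂' : firstTosses ω z.2.length = z.2 := h₂
    have h₄' : firstTosses ω w.2.length = w.2 := h₄
    rw [← h₂', ← h₄', (hT z hz).2, (hT w hw).2]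
  · intro z _
    exact MeasurableSet.prod trivial (measurableSet_tossesWithPrefix _)

/-! ### Runs that use finitely many tosses. -/

namespace ProbAlgorithm

variable (A : ProbAlgorithm)

/-- The algorithm `A`, run on `x`, outputs `v` after receiving at most the tosses in `r`. -/
def OutputsWithin (v : ℕ) (x r : List Bool) : Prop :=
  ∃ k ≤ r.length, (∀ j < k, none ∈ A.act x (r.take j)) ∧ some v ∈ A.act x (r.take k)

variable {A}

theorem outputs_iff_exists_outputsWithin {x : List Bool} {ω : ℕ → Bool} {v : ℕ} :
    A.Outputs x ω v ↔ ∃ K, A.OutputsWithin v x (firstTosses ω K) := by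
  constructor
  · rintro ⟨k, h, hk⟩
    refine ⟨k, k, by simp, fun j hj => ?_, ?_⟩
    · rw [take_firstTosses ω hj.le]; exact h j hj
    · rwa [take_firstTosses ω le_rfl]
  · rintro ⟨K, k, hkK, h, hk⟩
    rw [length_firstTosses] at hkK
    refine ⟨k, fun j hj => ?_, ?_⟩
    · rw [← take_firstTosses ω (hj.le.trans hkK)]; exact h j hj
    · rwa [← take_firstTosses ω hkK]

theorem OutputsWithin.mono {x : List Bool} {ω : ℕ → Bool} {v K L : ℕ} (hKL : K ≤ L)
    (h : A.OutputsWithin v x (firstTosses ω K)) : A.OutputsWithin v x (firstTosses ω L) := by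
  obtain ⟨k, hk, h₁, h₂⟩ := h
  rw [length_firstTosses] at hk
  refine ⟨k, by simpa using hk.trans hKL, fun j hj => ?_, ?_⟩
  · rw [take_firstTosses ω (by omega), ← take_firstTosses ω (hj.le.trans hk)]; exact h₁ j hj
  · rwa [take_firstTosses ω (by omega), ← take_firstTosses ω hk]

theorem Outputs.unique {x : List Bool} {ω : ℕ → Bool} {v w : ℕ} (hv : A.Outputs x ω v)
    (hw : A.Outputs x ω w) : v = w := by
  obtain ⟨k, h₁, h₂⟩ := hv
  obtain ⟨l, h₃, h₄⟩ := hw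
  rcases lt_trichotomy k l with h | rfl | h
  · exact absurd (Part.mem_unique h₂ (h₃ k h)) (by simp)
  · exact Option.some_injective _ (Part.mem_unique h₂ h₄)
  · exact absurd (Part.mem_unique h₄ (h₁ l h)) (by simp)

end ProbAlgorithm

/-! ### From error rates to counts of pairs of an input and tosses. -/

open Classical in
/-- The strings of length at most `n` outside `S`. -/
noncomputable def shortStringsNotMem (S : Set (List Bool)) (n : ℕ) : Finset (List Bool) :=
  (shortStrings n).filter (· ∉ S)

theorem prod_shortStringsNotMem (S : Set (List Bool)) (n : ℕ) :
    ((uniformInput n).prod coinMeasure)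
      ((shortStringsNotMem S n : Set (List Bool)) ×ˢ (Set.univ : Set (ℕ → Bool))) =
      (shortStringsNotMem S n).card * ((shortStrings n).card : ℝ≥0∞)⁻¹ := by
  classical
  rw [Measure.prod_prod, measure_univ, mul_one, uniformInput_apply]
  exact Finset.filter_subset _ _

section Arithmetic

variable {t N K e Z : ℕ}

theorem nat_le_of_measure_le (hN : 0 < N)
    (h : (t : ℝ≥0∞) * ((N : ℝ≥0∞)⁻¹ * (2 ^ K)⁻¹) ≤ Z * (N : ℝ≥0∞)⁻¹ + (2 ^ e)⁻¹) :
    2 ^ e * t ≤ 2 ^ K * (2 ^ e * Z + N) := by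
  have hN' : (N : ℝ≥0∞) ≠ 0 := by exact_mod_cast hN.ne'
  have h' := ENNReal.toReal_mono (by simp [ENNReal.mul_eq_top, hN']) h
  rw [ENNReal.toReal_add (by simp [ENNReal.mul_eq_top, hN']) (by simp)] at h'
  simp only [ENNReal.toReal_mul, ENNReal.toReal_inv, ENNReal.toReal_natCast, ENNReal.toReal_pow,
    ENNReal.toReal_ofNat] at h'
  have hN'' : (0 : ℝ) < N := by exact_mod_cast hN
  field_simp at h'
  have : (2 ^ e * t : ℝ) ≤ 2 ^ K * (2 ^ e * Z + N) := by linarith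
  exact_mod_cast this

theorem measure_le_of_nat_le (hN : 0 < N) (h : 2 ^ e * t + N * 2 ^ K ≤ 2 ^ e * 2 ^ K * Z) :
    (t : ℝ≥0∞) * ((N : ℝ≥0∞)⁻¹ * (2 ^ K)⁻¹) + (2 ^ e)⁻¹ ≤ Z * (N : ℝ≥0∞)⁻¹ := by
  have hN' : (N : ℝ≥0∞) ≠ 0 := by exact_mod_cast hN.ne'
  rw [← ENNReal.toReal_le_toReal (by simp [ENNReal.mul_eq_top, hN'])
    (by simp [ENNReal.mul_eq_top, hN']),
    ENNReal.toReal_add (by simp [ENNReal.mul_eq_top, hN']) (by simp)]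
  simp only [ENNReal.toReal_mul, ENNReal.toReal_inv, ENNReal.toReal_natCast, ENNReal.toReal_pow,
    ENNReal.toReal_ofNat]
  have hN'' : (0 : ℝ) < N := by exact_mod_cast hN
  have h' : (2 ^ e * t + N * 2 ^ K : ℝ) ≤ 2 ^ e * 2 ^ K * Z := by exact_mod_cast h
  field_simp
  linarith

end Arithmetic

/-- If `A` rarely errs, then it outputs `0` on few pairs of an input and tosses, compared to the
number of inputs outside `S`. -/
theorem card_le_of_errorRate_le {S : Set (List Bool)} {A : ProbAlgorithm} {n K e : ℕ}
    {T : Finset (List Bool × List Bool)} (h : errorRate S A n ≤ (2 ^ e)⁻¹)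
    (hT : ∀ z ∈ T, z.1.length ≤ n ∧ z.2.length = K ∧ A.OutputsWithin 0 z.1 z.2) :
    2 ^ e * T.card ≤
      2 ^ K * (2 ^ e * (shortStringsNotMem S n).card + (shortStrings n).card) := by
  classical
  apply nat_le_of_measure_le (card_shortStrings_pos n)
  rw [← prod_prefixEvent fun z hz => ⟨(hT z hz).1, (hT z hz).2.1⟩, ← prod_shortStringsNotMem]
  -- Only monotonicity and subadditivity are used, so `errorEvent` need not be measurable.
  refine (measure_mono ?_).trans ((measure_union_le _ (errorEvent S A)).trans
    (add_le_add le_rfl h))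
  rintro ⟨x, ω⟩ hx
  simp only [prefixEvent, Set.mem_iUnion] at hx
  obtain ⟨z, hz, rfl, hω⟩ := hx
  have hω' : firstTosses ω z.2.length = z.2 := hω
  have h₀ : A.Outputs z.1 ω 0 :=
    ProbAlgorithm.outputs_iff_exists_outputsWithin.2 ⟨_, hω'.symm ▸ (hT z hz).2.2⟩
  by_cases hS : z.1 ∈ S
  · exact Or.inr (Or.inl ⟨hS, fun h₁ => zero_ne_one (h₀.unique h₁)⟩)
  · exact Or.inl ⟨by simpa [shortStringsNotMem] using ⟨(hT z hz).1, hS⟩, trivial⟩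

/-- If `A` rarely errs, then it outputs `0` on many pairs of an input and tosses, compared to the
number of inputs outside `S`. -/
theorem exists_card_ge_of_errorRate_lt {S : Set (List Bool)} {A : ProbAlgorithm} {n e : ℕ}
    (h : errorRate S A n < (2 ^ e)⁻¹) :
    ∃ (K : ℕ) (T : Finset (List Bool × List Bool)),
      (∀ z ∈ T, z.1.length ≤ n ∧ z.2.length = K ∧ A.OutputsWithin 0 z.1 z.2) ∧
      2 ^ e * 2 ^ K * (shortStringsNotMem S n).card ≤
        2 ^ e * T.card + (shortStrings n).card * 2 ^ K := by
  classical
  -- If every `K` falls short, continuity from below passes the deficit of `2⁻ᵉ` to the event that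
  -- `0` is ever output, and the error is then at least `2⁻ᵉ`.
  by_contra! H
  let T : ℕ → Finset (List Bool × List Bool) := fun K =>
    (shortStrings n ×ˢ stringsOfLength K).filter fun z => A.OutputsWithin 0 z.1 z.2
  have hT : ∀ K, ∀ z ∈ T K, z.1.length ≤ n ∧ z.2.length = K ∧ A.OutputsWithin 0 z.1 z.2 := by
    intro K z hz
    simpa [T, and_assoc] using hz
  have hmem : ∀ K x ω, (x, ω) ∈ prefixEvent (T K) ↔
      x.length ≤ n ∧ A.OutputsWithin 0 x (firstTosses ω K) := by
    intro K x ω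
    simp only [prefixEvent, Set.mem_iUnion]
    constructor
    · rintro ⟨z, hz, rfl, hω⟩
      obtain ⟨h₁, h₂, h₃⟩ := hT K z hz
      have hω' : firstTosses ω z.2.length = z.2 := hω
      rw [h₂] at hω'
      exact ⟨h₁, hω'.symm ▸ h₃⟩
    · rintro ⟨h₁, h₂⟩
      refine ⟨(x, firstTosses ω K), by simp [T, h₁, h₂], rfl, ?_⟩
      simp [tossesWithPrefix]
  set μ := (uniformInput n).prod coinMeasure with hμ
  have hK : ∀ K, μ (prefixEvent (T K)) + (2 ^ e)⁻¹ ≤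
      (shortStringsNotMem S n).card * ((shortStrings n).card : ℝ≥0∞)⁻¹ := fun K => by
    rw [hμ, prod_prefixEvent fun z hz => ⟨(hT K z hz).1, (hT K z hz).2.1⟩]
    exact measure_le_of_nat_le (card_shortStrings_pos n) (H K (T K) (hT K)).le
  have hmono : Monotone fun K => prefixEvent (T K) := fun K L hKL => by
    rintro ⟨x, ω⟩ hx
    rw [hmem] at hx
    exact (hmem _ _ _).2 ⟨hx.1, hx.2.mono hKL⟩
  have hsup : μ (⋃ K, prefixEvent (T K)) + (2 ^ e)⁻¹ ≤
      (shortStringsNotMem S n).card * ((shortStrings n).card : ℝ≥0∞)⁻¹ := by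
    rw [hmono.measure_iUnion, ENNReal.iSup_add]
    exact iSup_le hK
  rw [← prod_shortStringsNotMem] at hsup
  have hsub : (shortStringsNotMem S n : Set (List Bool)) ×ˢ (Set.univ : Set (ℕ → Bool)) ⊆
      (⋃ K, prefixEvent (T K)) ∪ errorEvent S A := by
    rintro ⟨x, ω⟩ ⟨hx, -⟩
    have hx' : x.length ≤ n ∧ x ∉ S := by simpa [shortStringsNotMem] using hx
    by_cases h₀ : A.Outputs x ω 0
    · obtain ⟨K, h₀K⟩ := ProbAlgorithm.outputs_iff_exists_outputsWithin.1 h₀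
      exact Or.inl (Set.mem_iUnion.2 ⟨K, (hmem _ _ _).2 ⟨hx'.1, h₀K⟩⟩)
    · exact Or.inr (Or.inr ⟨hx'.2, h₀⟩)
  have := hsup.trans ((measure_mono hsub).trans (measure_union_le _ _))
  exact absurd ((ENNReal.add_le_add_iff_left (measure_ne_top _ _)).1 this) (not_le.2 h)

/-! ### Primitive recursive auxiliaries. -/

theorem primrec_two_pow : Primrec fun n : ℕ => 2 ^ n :=
  (Primrec.nat_rec₁ 1 (Primrec.nat_double.comp Primrec.snd).to₂).of_eq fun n => by
    induction n with
    | zero => rfl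
    | succ n ih => rw [pow_succ, mul_comm]; exact congrArg (2 * ·) ih

theorem primrec_replicate {α : Type*} [Primcodable α] (a : α) :
    Primrec fun n : ℕ => List.replicate n a :=
  (Primrec.list_map Primrec.list_range (Primrec.const a).to₂).of_eq fun n => by simp

theorem primrecPred_list_nodup {α : Type*} [Primcodable α] [DecidableEq α] :
    PrimrecPred fun l : List α => l.Nodup := by
  have h : Primrec fun l : List α =>
      l.foldr (fun a (s : List α) => if a ∈ s then s else a :: s) [] := by
    have hmem : PrimrecRel fun (a : α) (s : List α) => a ∈ s := by
      have : PrimrecRel fun (s : List α) (a : α) => ∃ b ∈ s, b = a :=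
        Primrec.eq.exists_mem_list
      exact this.swap.of_eq fun a s => by simp [Function.swap]
    refine Primrec.list_foldr (h := fun _ z => if z.1 ∈ z.2 then z.2 else z.1 :: z.2)
      Primrec.id (Primrec.const ([] : List α)) ?_
    exact Primrec.ite (hmem.comp (Primrec.fst.comp Primrec.snd) (Primrec.snd.comp Primrec.snd))
      (Primrec.snd.comp Primrec.snd)
      (Primrec.list_cons.comp (Primrec.fst.comp Primrec.snd) (Primrec.snd.comp Primrec.snd))
  refine (Primrec.eq.comp h Primrec.id).of_eq fun l => ?_
  have h' : l.foldr (fun a (s : List α) => if a ∈ s then s else a :: s) [] = l.dedup := by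
    induction l with
    | nil => rfl
    | cons a l ih =>
      rw [List.foldr_cons, ih]
      split_ifs with ha
      · rw [List.dedup_cons_of_mem (by simpa using ha)]
      · rw [List.dedup_cons_of_notMem (by simpa using ha)]
  rw [h']
  exact List.dedup_eq_self

/-! ### Certificates: enumerability, existence and accuracy. -/

/-- The run of the `n`-th algorithm of the family `act` on `x` outputs `0` after receiving at most
the tosses in `r`. -/
def FamilyOutputsZero (act : ℕ × List Bool × List Bool →. Option ℕ)
    (z : ℕ × List Bool × List Bool) : Prop :=
  ∃ k, k ≤ z.2.2.length ∧ (∀ j ∈ List.range k, none ∈ act (z.1, z.2.1, z.2.2.take j)) ∧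
    some 0 ∈ act (z.1, z.2.1, z.2.2.take k)

theorem isSigmaOne_familyOutputsZero {act : ℕ × List Bool × List Bool →. Option ℕ}
    (hact : Partrec act) : IsSigmaOne (FamilyOutputsZero act) := by
  have hrun := IsSigmaOne.mem_of_partrec hact
  have harg : Primrec fun w : ℕ × (ℕ × List Bool × List Bool) =>
      (w.2.1, w.2.2.1, w.2.2.2.take w.1) := by
    have h₁ := Primrec.fst.comp (Primrec.snd (α := ℕ) (β := ℕ × List Bool × List Bool))
    have h₂ := Primrec.snd.comp (Primrec.snd (α := ℕ) (β := ℕ × List Bool × List Bool))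
    exact h₁.pair ((Primrec.fst.comp h₂).pair
      (Primrec.list_take.comp Primrec.fst (Primrec.snd.comp h₂)))
  have hask : IsSigmaOne fun w : ℕ × (ℕ × List Bool × List Bool) =>
      none ∈ act (w.2.1, w.2.2.1, w.2.2.2.take w.1) :=
    hrun.comp (harg.pair (Primrec.const none))
  have hhalt : IsSigmaOne fun w : (ℕ × List Bool × List Bool) × ℕ =>
      some 0 ∈ act (w.1.1, w.1.2.1, w.1.2.2.take w.2) :=
    hrun.comp ((harg.comp (Primrec.snd.pair Primrec.fst)).pair (Primrec.const (some 0)))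
  have hlen : IsSigmaOne fun w : (ℕ × List Bool × List Bool) × ℕ => w.2 ≤ w.1.2.2.length :=
    .of_primrecPred (Primrec.nat_le.comp Primrec.snd
      (Primrec.list_length.comp (Primrec.snd.comp (Primrec.snd.comp Primrec.fst))))
  exact (hlen.and ((hask.forall_mem_list.comp
    ((Primrec.list_range.comp Primrec.snd).pair Primrec.fst)).and hhalt)).exists_snd

theorem familyOutputsZero_iff {act : ℕ × List Bool × List Bool →. Option ℕ} {A : ProbAlgorithm}
    {n : ℕ} (hA : ∀ x r, A.act x r = act (n, x, r)) (x r : List Bool) :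
    FamilyOutputsZero act (n, x, r) ↔ A.OutputsWithin 0 x r := by
  simp [FamilyOutputsZero, ProbAlgorithm.OutputsWithin, hA]

/-- The data `((K, M), P, R)` of a certificate. -/
abbrev CertificateData : Type :=
  (ℕ × ℕ) × List (List Bool) × List (List Bool × List Bool)

/-- `((K, M), P, R)` witnesses that `P` exhausts the domain of `U` among the strings of length at
most `n`, up to a fraction that is small if the `n`-th algorithm of the family `act` rarely errs:
`P` consists of programs of `U` whose outputs are shorter than `M`, and `R` of pairs of an input
and `K` tosses for which the algorithm outputs `0`. -/
def IsCertificate (U : List Bool →. List Bool) (act : ℕ × List Bool × List Bool →. Option ℕ)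
    (a : (ℕ × ℕ) × CertificateData) : Prop :=
  (a.2.2.1.Nodup ∧ a.2.2.2.Nodup ∧
    2 ^ a.1.1 * 2 ^ a.2.1.1 * (2 ^ (a.1.2 + 1) - 1) ≤
      2 ^ a.1.1 * (a.2.2.2.length + a.2.2.1.length * 2 ^ a.2.1.1) +
        (2 ^ (a.1.2 + 1) - 1) * 2 ^ a.2.1.1) ∧
  (∀ p ∈ a.2.2.1, ∃ y, (p.length ≤ a.1.2 ∧ y.length < a.2.1.2) ∧ y ∈ U p) ∧
  ∀ z ∈ a.2.2.2, (z.1.length ≤ a.1.2 ∧ z.2.length = a.2.1.1) ∧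
    FamilyOutputsZero act (a.1.2, z.1, z.2)

theorem isSigmaOne_isCertificate {U : List Bool →. List Bool} (hU : Partrec U)
    {act : ℕ × List Bool × List Bool →. Option ℕ} (hact : Partrec act) :
    IsSigmaOne (IsCertificate U act) := by
  have he : Primrec fun a : (ℕ × ℕ) × CertificateData => a.1.1 := Primrec.fst.comp Primrec.fst
  have hn : Primrec fun a : (ℕ × ℕ) × CertificateData => a.1.2 := Primrec.snd.comp Primrec.fst
  have hK : Primrec fun a : (ℕ × ℕ) × CertificateData => a.2.1.1 :=
    Primrec.fst.comp (Primrec.fst.comp Primrec.snd)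
  have hM : Primrec fun a : (ℕ × ℕ) × CertificateData => a.2.1.2 :=
    Primrec.snd.comp (Primrec.fst.comp Primrec.snd)
  have hP : Primrec fun a : (ℕ × ℕ) × CertificateData => a.2.2.1 :=
    Primrec.fst.comp (Primrec.snd.comp Primrec.snd)
  have hR : Primrec fun a : (ℕ × ℕ) × CertificateData => a.2.2.2 :=
    Primrec.snd.comp (Primrec.snd.comp Primrec.snd)
  have hN : Primrec fun a : (ℕ × ℕ) × CertificateData => 2 ^ (a.1.2 + 1) - 1 :=
    Primrec.nat_sub.comp (primrec_two_pow.comp (Primrec.succ.comp hn)) (Primrec.const 1)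
  have h2e := primrec_two_pow.comp he
  have h2K := primrec_two_pow.comp hK
  refine (IsSigmaOne.of_primrecPred ?_).and (IsSigmaOne.and ?_ ?_)
  · refine (primrecPred_list_nodup.comp hP).and ((primrecPred_list_nodup.comp hR).and ?_)
    exact Primrec.nat_le.comp (Primrec.nat_mul.comp (Primrec.nat_mul.comp h2e h2K) hN)
      (Primrec.nat_add.comp (Primrec.nat_mul.comp h2e (Primrec.nat_add.comp
        (Primrec.list_length.comp hR) (Primrec.nat_mul.comp (Primrec.list_length.comp hP) h2K)))
        (Primrec.nat_mul.comp hN h2K))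
  · have hp : IsSigmaOne fun w : List Bool × ((ℕ × ℕ) × CertificateData) =>
        ∃ y : List Bool, (w.1.length ≤ w.2.1.2 ∧ y.length < w.2.2.1.2) ∧ y ∈ U w.1 := by
      refine IsSigmaOne.exists_snd (p := fun v : (List Bool × ((ℕ × ℕ) × CertificateData)) ×
        List Bool => (v.1.1.length ≤ v.1.2.1.2 ∧ v.2.length < v.1.2.2.1.2) ∧ v.2 ∈ U v.1.1)
        ((IsSigmaOne.of_primrecPred (PrimrecPred.and ?_ ?_)).and
        ((IsSigmaOne.mem_of_partrec hU).comp
          ((Primrec.fst.comp Primrec.fst).pair Primrec.snd)))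
      · exact Primrec.nat_le.comp (Primrec.list_length.comp (Primrec.fst.comp Primrec.fst))
          (hn.comp (Primrec.snd.comp Primrec.fst))
      · exact Primrec.nat_lt.comp (Primrec.list_length.comp Primrec.snd)
          (hM.comp (Primrec.snd.comp Primrec.fst))
    exact hp.forall_mem_list.comp (hP.pair Primrec.id)
  · have hz : IsSigmaOne fun w : (List Bool × List Bool) × ((ℕ × ℕ) × CertificateData) =>
        (w.1.1.length ≤ w.2.1.2 ∧ w.1.2.length = w.2.2.1.1) ∧
          FamilyOutputsZero act (w.2.1.2, w.1.1, w.1.2) := by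
      refine (IsSigmaOne.of_primrecPred (PrimrecPred.and ?_ ?_)).and
        ((isSigmaOne_familyOutputsZero hact).comp ((hn.comp Primrec.snd).pair Primrec.fst))
      · exact Primrec.nat_le.comp (Primrec.list_length.comp (Primrec.fst.comp Primrec.fst))
          (hn.comp Primrec.snd)
      · exact Primrec.eq.comp (Primrec.list_length.comp (Primrec.snd.comp Primrec.fst))
          (hK.comp Primrec.snd)
    exact hz.forall_mem_list.comp (hR.pair Primrec.id)

open Classical in
theorem card_shortStrings_mem_add (S : Set (List Bool)) (n : ℕ) :
    ((shortStrings n).filter (· ∈ S)).card + (shortStringsNotMem S n).card =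
      (shortStrings n).card :=
  Finset.card_filter_add_card_filter_not _

theorem two_pow_sub_one_eq_card_shortStrings (n : ℕ) :
    2 ^ (n + 1) - 1 = (shortStrings n).card := by
  rw [← card_shortStrings, Nat.add_sub_cancel]

/-- The whole domain up to length `n` serves as `P`. It is not computed; its existence only
guarantees that the search ends, possibly at another certificate. -/
theorem exists_isCertificate {U : List Bool →. List Bool}
    {act : ℕ × List Bool × List Bool →. Option ℕ} {A : ProbAlgorithm} {e n : ℕ}
    (hA : ∀ x r, A.act x r = act (n, x, r)) (h : errorRate U.Dom A n < (2 ^ e)⁻¹) :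
    ∃ b, IsCertificate U act ((e, n), b) := by
  classical
  obtain ⟨K, T, hT, hcard⟩ := exists_card_ge_of_errorRate_lt h
  have hdom : ∀ p : List Bool, ∃ y, p ∈ U.Dom → y ∈ U p := fun p => by
    by_cases hp : p ∈ U.Dom
    · exact ⟨(U p).get hp, fun _ => Part.get_mem _⟩
    · exact ⟨[], fun h => absurd h hp⟩
  choose out hout using hdom
  set D := (shortStrings n).filter (· ∈ U.Dom) with hD
  -- The sum plus one strictly exceeds the length of every output.
  refine ⟨((K, (∑ p ∈ D, (out p).length) + 1), D.toList, T.toList),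
    ⟨Finset.nodup_toList _, Finset.nodup_toList _, ?_⟩, fun p hp => ?_, fun z hz => ?_⟩
  · simp only [Finset.length_toList, two_pow_sub_one_eq_card_shortStrings]
    have hsum := card_shortStrings_mem_add U.Dom n
    rw [← hD] at hsum
    calc 2 ^ e * 2 ^ K * (shortStrings n).card
        = 2 ^ e * 2 ^ K * (shortStringsNotMem U.Dom n).card + 2 ^ e * (D.card * 2 ^ K) := by
          rw [← hsum]; ring
      _ ≤ _ := by rw [mul_add]; omega
  · have hp' : p ∈ D := Finset.mem_toList.1 hp
    have hp'' : p.length ≤ n ∧ p ∈ U.Dom := by simpa [hD] using hp'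
    refine ⟨out p, ⟨hp''.1, Nat.lt_succ_of_le ?_⟩, hout p hp''.2⟩
    exact Finset.single_le_sum (f := fun p => (out p).length) (fun _ _ => Nat.zero_le _) hp'
  · obtain ⟨h₁, h₂, h₃⟩ := hT z (Finset.mem_toList.1 hz)
    exact ⟨⟨h₁, h₂⟩, (familyOutputsZero_iff hA _ _).2 h₃⟩

open Classical in
/-- If the algorithm rarely errs, then a certificate misses few strings of the domain. -/
theorem IsCertificate.card_le {U : List Bool →. List Bool}
    {act : ℕ × List Bool × List Bool →. Option ℕ} {A : ProbAlgorithm} {e n : ℕ}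
    (hA : ∀ x r, A.act x r = act (n, x, r)) (h : errorRate U.Dom A n ≤ (2 ^ e)⁻¹)
    {b : CertificateData} (hb : IsCertificate U act ((e, n), b)) :
    2 ^ e * (((shortStrings n).filter (· ∈ U.Dom)) \ b.2.1.toFinset).card <
      2 ^ (n + 2) := by
  obtain ⟨⟨K, M⟩, P, R⟩ := b
  obtain ⟨⟨hP, hR, hcard⟩, hPU, hRA⟩ := hb
  simp only [two_pow_sub_one_eq_card_shortStrings] at hcard hPU hRA hP hR ⊢
  set D := (shortStrings n).filter (· ∈ U.Dom) with hD
  have hsub : P.toFinset ⊆ D := fun p hp => by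
    obtain ⟨y, ⟨hlen, -⟩, hy⟩ := hPU p (List.mem_toFinset.1 hp)
    simpa [hD, hlen] using ⟨y, hy⟩
  have hDP := Finset.card_sdiff_add_card_eq_card hsub
  rw [List.toFinset_card_of_nodup hP] at hDP
  have hT := card_le_of_errorRate_le (K := K) (T := R.toFinset) h fun z hz => by
    obtain ⟨⟨h₁, h₂⟩, h₃⟩ := hRA z (List.mem_toFinset.1 hz)
    exact ⟨h₁, h₂, (familyOutputsZero_iff hA _ _).1 h₃⟩
  rw [List.toFinset_card_of_nodup hR] at hT
  have hsum := card_shortStrings_mem_add U.Dom n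
  rw [← hD] at hsum
  have hN := card_shortStrings n
  -- Eliminating the length of `R` between `hcard` and `hT` leaves two error terms `N * 2 ^ K`,
  -- whence the factor `2`.
  have key : 2 ^ K * (2 ^ e * (D \ P.toFinset).card) ≤ 2 ^ K * (2 * (shortStrings n).card) := by
    rw [← hsum, ← hDP] at hcard hT ⊢
    nlinarith
  have := Nat.le_of_mul_le_mul_left key (by positivity)
  rw [pow_succ]
  omega

/-! ### The contradiction with optimality, and the theorem. -/

theorem exists_program_of_complexity_le {U : List Bool →. List Bool} {x : List Bool} {n : ℕ}
    (h : complexity U x ≤ n) : ∃ p : List Bool, p.length ≤ n ∧ x ∈ U p := by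
  by_contra! H
  have : ((n + 1 : ℕ) : ℕ∞) ≤ complexity U x :=
    le_iInf₂ fun p hp => by
      have : n < p.length := by
        by_contra! hlen
        exact H p hlen hp
      exact_mod_cast this
  have := this.trans h
  norm_cast at this
  omega

theorem complexity_le_length {U : List Bool →. List Bool} {x p : List Bool} (h : x ∈ U p) :
    complexity U x ≤ p.length :=
  iInf₂_le p h

/-- No algorithm of a computable family is rarely wrong at its own index. -/
theorem exists_forall_le_errorRate {U : List Bool →. List Bool} (hU : IsOptimal U)
    {act : ℕ × List Bool × List Bool →. Option ℕ} (hact : Partrec act) :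
    ∃ ε : ℝ≥0∞, 0 < ε ∧ ∃ n₀ : ℕ, ∀ n ≥ n₀, ∀ A : ProbAlgorithm,
      (∀ x r, A.act x r = act (n, x, r)) → ε ≤ errorRate U.Dom A n := by
  classical
  obtain ⟨g, hg, hg_sound, hg_dom⟩ := (isSigmaOne_isCertificate hU.1 hact).exists_selector
  -- The number of leading `false` bits is a self-delimiting code for `d`, so `V` can be fixed
  -- before its optimality constant is known.
  let zeros : List Bool → ℕ := fun p => p.idxOf true
  have hzeros : Primrec zeros := Primrec.list_idxOf.comp (Primrec.const true) Primrec.id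
  -- On `0ᵈ1q` with `|q| = m` this is `e = 2d + 3` and `n = m + 2d + 1`: input length `m + d + 1`
  -- plus the constant `d`. Thus `n + 2 - e = m`.
  let arg : List Bool → ℕ × ℕ := fun p => (2 * zeros p + 3, p.length + zeros p)
  have harg : Primrec arg :=
    (Primrec.nat_add.comp (Primrec.nat_double.comp hzeros) (Primrec.const 3)).pair
      (Primrec.nat_add.comp Primrec.list_length hzeros)
  let V : List Bool →. List Bool := fun p =>
    (g (arg p)).map fun b => List.replicate b.1.2 true ++ p.drop (zeros p + 1)
  have hV : IsMachine V := by
    refine (hg.comp harg.to_comp).map (Primrec.to_comp ?_)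
    exact Primrec.list_append.comp
      ((primrec_replicate true).comp (Primrec.snd.comp (Primrec.fst.comp Primrec.snd)))
      (Primrec.list_drop.comp (Primrec.succ.comp (hzeros.comp Primrec.fst)) Primrec.fst)
  obtain ⟨d, hd⟩ := hU.2 V hV
  refine ⟨(2 ^ (2 * d + 3))⁻¹, by simp, 2 * d + 1, fun n hn A hA => ?_⟩
  by_contra! hlt
  obtain ⟨m, rfl⟩ := Nat.exists_eq_add_of_le' hn
  obtain ⟨b₀, hb₀⟩ := exists_isCertificate hA hlt
  have hdom := hg_dom _ _ hb₀
  set b := (g (2 * d + 3, m + (2 * d + 1))).get hdom with hb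
  have hmem : b ∈ g (2 * d + 3, m + (2 * d + 1)) := Part.get_mem _
  have hcert := hg_sound _ _ hmem
  have hsmall := hcert.card_le hA hlt.le
  have hVq : ∀ q ∈ stringsOfLength m, ∃ p : List Bool, p.length ≤ m + (2 * d + 1) ∧
      List.replicate b.1.2 true ++ q ∈ U p := by
    intro q hq
    have hq' : q.length = m := mem_stringsOfLength.1 hq
    have hz : zeros (List.replicate d false ++ true :: q) = d := by
      simp [zeros, List.idxOf_append]
    have hout : List.replicate b.1.2 true ++ q ∈ V (List.replicate d false ++ true :: q) := by
      have harg' : arg (List.replicate d false ++ true :: q) =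
          (2 * d + 3, m + (2 * d + 1)) := by
        simp only [arg, hz]
        refine Prod.ext rfl ?_
        simp [hq']
        omega
      refine Part.mem_map_iff _ |>.2 ⟨b, by rw [harg']; exact hmem, ?_⟩
      rw [hz]
      simp [List.drop_append]
    apply exists_program_of_complexity_le
    refine (hd _).trans ((add_le_add_left (complexity_le_length hout) _).trans ?_)
    simp only [List.length_append, List.length_replicate, List.length_cons, hq']
    norm_cast
    omega
  choose! f hf using hVq
  have hcard : 2 ^ m ≤ (((shortStrings (m + (2 * d + 1))).filter (· ∈ U.Dom)) \
      b.2.1.toFinset).card := by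
    rw [← card_stringsOfLength]
    refine Finset.card_le_card_of_injOn f (fun q hq => ?_) fun q hq q' hq' hqq' => ?_
    · obtain ⟨hlen, hy⟩ := hf q hq
      simp only [Finset.coe_sdiff, Set.mem_sdiff, Finset.mem_coe, Finset.mem_filter,
        mem_shortStrings, List.mem_toFinset]
      refine ⟨⟨hlen, Part.dom_iff_mem.2 ⟨_, hy⟩⟩, fun hP => ?_⟩
      -- A listed program has output shorter than `M`, while `f q` outputs at least `M` symbols.
      obtain ⟨y, ⟨-, hlt⟩, hy'⟩ := hcert.2.1 _ hP
      rw [← Part.mem_unique hy hy'] at hlt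
      simp at hlt
    · have h₁ := (hf q hq).2
      rw [hqq'] at h₁
      exact List.append_cancel_left (Part.mem_unique h₁ (hf q' hq').2)
  have := (Nat.mul_le_mul_left (2 ^ (2 * d + 3)) hcard).trans_lt hsmall
  rw [← pow_add] at this
  exact absurd (Nat.pow_lt_pow_iff_right (by norm_num) |>.1 this) (by omega)

theorem mainTheorem8 (U : List Bool →. List Bool) (hU : IsOptimal U) :
    (∀ A : ProbAlgorithm, 0 < lowerErrorRate U.Dom A) ∧
      ∃ ε : ℝ≥0∞, 0 < ε ∧ ∀ A : ProbAlgorithm, ε ≤ upperErrorRate U.Dom A := by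
  constructor
  · intro A
    obtain ⟨ε, hε, n₀, h⟩ := exists_forall_le_errorRate hU
      (act := fun z => A.act z.2.1 z.2.2)
      (A.partrec_act.comp (Computable.fst.comp Computable.snd)
        (Computable.snd.comp Computable.snd))
    refine hε.trans_le (le_liminf_of_le (by isBoundedDefault) ?_)
    exact eventually_atTop.2 ⟨n₀, fun n hn => h n hn A fun _ _ => rfl⟩
  -- The index `n` is read as a pair whose first component codes the algorithm; the second is
  -- padding.
  · let code : ℕ → Nat.Partrec.Code := fun n => Denumerable.ofNat _ n.unpair.1
    have hcode : Computable code :=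
      (Computable.ofNat _).comp (Computable.fst.comp Computable.unpair)
    let act : ℕ × List Bool × List Bool →. Option ℕ := fun z =>
      ((code z.1).eval (Encodable.encode z.2)).bind fun v =>
        (Encodable.decode (α := Option ℕ) v : Part (Option ℕ))
    have hact : Partrec act :=
      (Nat.Partrec.Code.eval_part.comp (hcode.comp Computable.fst)
        (Computable.encode.comp Computable.snd)).bind
        (Computable.ofOption (Computable.decode.comp Computable.snd))
    obtain ⟨ε, hε, n₀, h⟩ := exists_forall_le_errorRate hU hact
    refine ⟨ε, hε, fun A => le_limsup_of_frequently_le (frequently_atTop.2 fun m => ?_)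
      (by isBoundedDefault)⟩
    obtain ⟨c, hc⟩ := Nat.Partrec.Code.exists_code.1 A.partrec_act
    -- Padding places the same algorithm at indices beyond any bound, which is why only the limsup
    -- is controlled uniformly.
    have hle : max m n₀ ≤ Nat.pair (Encodable.encode c) (max m n₀) := Nat.right_le_pair _ _
    refine ⟨Nat.pair (Encodable.encode c) (max m n₀), (le_max_left _ _).trans hle,
      h _ ((le_max_right _ _).trans hle) A fun x r => ?_⟩
    have hcc : code (Nat.pair (Encodable.encode c) (max m n₀)) = c := by simp [code]
    simp only [act, hcc, hc]
    simp
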